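/- **Proposition (Tightness).** Fix an integer $n\ge 2$. For an odd prime $p$ and $a,b\in(\mathbb{Z}/p^n\mathbb{Z})^\times$, let $j_1<\dots<j_{\varphi(p^n)}$ be the integers in $\{1,\dots,p^n\}$ that are not divisible by $p$, and put $$z_i=\frac{1}{p^{n/2}}\sum_{\substack{1\le x\le j_i\\ p\nmid x}}\exp\!\left(2i\pi\,\frac{ax+b\overline{x}}{p^n}\right)\qquad(1\le i\le\varphi(p^n)),$$ where $\overline{x}$ is the inverse of $x$ modulo $p^n$. Let $t\mapsto \mathsf{Kl}_{p^n}(t;(a,b))$ be the continuous map $[0,1]\to\mathbb{C}$ that takes the value $z_i$ at $t=\frac{i-1}{\varphi(p^n)-1}$ for $1\le i\le\varphi(p^n)$ and is affine on each interval $\left[\frac{i-1}{\varphi(p^n)-1},\frac{i}{\varphi(p^n)-1}\right]$, $1\le i\le\varphi(p^n)-1$. View $(a,b)\mapsto\mathsf{Kl}_{p^n}(\,\cdot\,;(a,b))$ as a random variable on $(\mathbb{Z}/p^n\mathbb{Z})^\times\times(\mathbb{Z}/p^n\mathbb{Z})^\times$, endowed with the uniform probability measure, with values in the Banach space $C^0([0,1],\mathbb{C})$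 endowed with the supremum norm, and let $\mu_p$ be its law. Then the family $(\mu_p)_p$, where $p$ runs over all odd primes, is tight: for every $\varepsilon>0$ there is a compact subset $K$ of $C^0([0,1],\mathbb{C})$ such that $\mu_p(K)\ge 1-\varepsilon$ for every odd prime $p$. -/

import Mathlib

open MeasureTheory ProbabilityTheory

noncomputable section

namespace KloostermanPath

/-- The partial normalized Kloosterman sum
`p^(-n/2) * ∑_{1 ≤ x ≤ m, p ∤ x} e((a x + b x⁻¹) / p^n)`, where `x⁻¹` is the inverse of `x`
modulo `p^n` and `ZMod.stdAddChar` is the character `j ↦ exp(2 π i j / p^n)` of `ℤ/p^nℤ`. -/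
def partialSum (p n : ℕ) [Fact p.Prime] (ab : (ZMod (p ^ n))ˣ × (ZMod (p ^ n))ˣ) (m : ℕ) : ℂ :=
  (((1 : ℝ) / (p : ℝ) ^ ((n : ℝ) / 2) : ℝ) : ℂ) *
    ∑ x ∈ (Finset.Icc 1 m).filter (fun x => ¬ p ∣ x),
      ZMod.stdAddChar ((ab.1 : ZMod (p ^ n)) * (x : ZMod (p ^ n)) +
        (ab.2 : ZMod (p ^ n)) * (x : ZMod (p ^ n))⁻¹)

/-- The `j`-th positive integer not divisible by `p` (for `j ≥ 1`). -/
def index (p j : ℕ) : ℕ := j + (j - 1) / (p - 1)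

/-- The vertices `z_1, z_2, …, z_{φ(p^n)}` of the Kloosterman path: the successive partial
sums at the integers `1 ≤ j_1 < j_2 < …` not divisible by `p`. -/
def vertex (p n : ℕ) [Fact p.Prime] (ab : (ZMod (p ^ n))ˣ × (ZMod (p ^ n))ˣ) (j : ℕ) : ℂ :=
  partialSum p n ab (index p j)

/-- The number `φ(p^n) - 1` of segments of the path. -/
def numSeg (p n : ℕ) : ℕ := Nat.totient (p ^ n) - 1

/-- The number of the segment on which the path is at time `t ∈ [0,1]`. It is
`⌈(φ(p^n) - 1) t⌉` for `t > 0`; time `0` belongs to the first segment. -/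
def segIndex (p n : ℕ) (t : ℝ) : ℕ := max 1 ⌈(numSeg p n : ℝ) * t⌉₊

/-- The polygonal path through `z_1, …, z_{φ(p^n)}`, each of the `φ(p^n) - 1` segments being
parametrized linearly by an interval of length `1 / (φ(p^n) - 1)`. -/
def pathFun (p n : ℕ) [Fact p.Prime] (ab : (ZMod (p ^ n))ˣ × (ZMod (p ^ n))ˣ) (t : ℝ) : ℂ :=
  let j := segIndex p n t
  (numSeg p n : ℂ) * (vertex p n ab (j + 1) - vertex p n ab j) *
      ((t - ((j : ℝ) - 1) / (numSeg p n : ℝ) : ℝ) : ℂ) + vertex p n ab j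

/-- On `[0,1]` the path is a sum of increments switched on continuously, one after the other. -/
theorem pathFun_eq_sum (p n : ℕ) [Fact p.Prime] (ab : (ZMod (p ^ n))ˣ × (ZMod (p ^ n))ˣ)
    (t : ℝ) (ht : t ∈ Set.Icc (0 : ℝ) 1) :
    pathFun p n ab t = vertex p n ab 1 + ∑ i ∈ Finset.range (numSeg p n),
      (vertex p n ab (i + 2) - vertex p n ab (i + 1)) *
        ((max 0 (min 1 ((numSeg p n : ℝ) * t - (i : ℝ))) : ℝ) : ℂ) := by
  obtain ⟨h0, h1⟩ := ht
  rcases Nat.eq_zero_or_pos (numSeg p n) with hN | hN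
  · simp [pathFun, segIndex, hN]
  generalize hz : vertex p n ab = z
  simp only [pathFun, hz]
  generalize hj : segIndex p n t = j
  unfold segIndex at hj
  generalize numSeg p n = N at *
  have hNR : (0 : ℝ) < N := by exact_mod_cast hN
  have hj1 : 1 ≤ j := by omega
  have hjN : j ≤ N := by
    have : ⌈(N : ℝ) * t⌉₊ ≤ N := Nat.ceil_le.2 (by nlinarith)
    omega
  have hup : (N : ℝ) * t ≤ j := by
    have h := Nat.le_ceil ((N : ℝ) * t)
    have : ((⌈(N : ℝ) * t⌉₊ : ℕ) : ℝ) ≤ j := by exact_mod_cast (by omega)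
    linarith
  have hlow : (j : ℝ) - 1 ≤ (N : ℝ) * t := by
    rcases Nat.lt_or_ge 1 j with h | h
    · have : j - 1 < ⌈(N : ℝ) * t⌉₊ := by omega
      have := Nat.lt_ceil.1 this
      rw [Nat.cast_sub hj1] at this
      push_cast at this
      linarith
    · have : j = 1 := by omega
      subst this
      have : 0 ≤ (N : ℝ) * t := by positivity
      simpa using this
  obtain ⟨k, rfl⟩ : ∃ k, j = k + 1 := ⟨j - 1, by omega⟩
  obtain ⟨r, rfl⟩ : ∃ r, N = (k + 1) + r := ⟨N - (k + 1), by omega⟩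
  generalize hM : (((k + 1 + r : ℕ) : ℝ)) * t = s at *
  push_cast at hup hlow
  rw [Finset.sum_range_add, Finset.sum_range_succ]
  have e1 : ∑ i ∈ Finset.range k, (z (i + 2) - z (i + 1)) *
      ((max 0 (min 1 (s - (i : ℝ))) : ℝ) : ℂ) = z (k + 1) - z 1 := by
    rw [← Finset.sum_range_sub (fun i => z (i + 1)) k]
    refine Finset.sum_congr rfl fun i hi => ?_
    have hi' : (i : ℝ) + 1 ≤ k := by exact_mod_cast Finset.mem_range.1 hi
    rw [min_eq_left (by linarith), max_eq_right zero_le_one]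
    simp
  have e2 : ∑ i ∈ Finset.range r, (z (k + 1 + i + 2) - z (k + 1 + i + 1)) *
      ((max 0 (min 1 (s - ((k + 1 + i : ℕ) : ℝ))) : ℝ) : ℂ) = 0 := by
    refine Finset.sum_eq_zero fun i _ => ?_
    have : (0 : ℝ) ≤ i := Nat.cast_nonneg i
    rw [max_eq_left]
    · simp
    · refine (min_le_right _ _).trans ?_
      push_cast
      linarith
  have e3 : max 0 (min 1 (s - (k : ℝ))) = s - k := by
    rw [min_eq_right (by linarith), max_eq_right (by linarith)]
  rw [e1, e2, e3]
  have e4 : t - (((k + 1 : ℕ) : ℝ) - 1) / ((k + 1 + r : ℕ) : ℝ)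
      = (s - k) / ((k + 1 + r : ℕ) : ℝ) := by
    rw [← hM]
    field_simp
    push_cast
    ring
  rw [e4]
  have hC : ((k + 1 + r : ℕ) : ℂ) ≠ 0 := by exact_mod_cast hNR.ne'
  rw [Complex.ofReal_div, Complex.ofReal_natCast]
  field_simp
  ring

theorem continuous_pathFun (p n : ℕ) [Fact p.Prime]
    (ab : (ZMod (p ^ n))ˣ × (ZMod (p ^ n))ˣ) :
    Continuous fun t : Set.Icc (0 : ℝ) 1 => pathFun p n ab t := by
  have h : (fun t : Set.Icc (0 : ℝ) 1 => pathFun p n ab t) = fun t : Set.Icc (0 : ℝ) 1 =>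
      vertex p n ab 1 + ∑ i ∈ Finset.range (numSeg p n),
        (vertex p n ab (i + 2) - vertex p n ab (i + 1)) *
          ((max 0 (min 1 ((numSeg p n : ℝ) * (t : ℝ) - (i : ℝ))) : ℝ) : ℂ) :=
    funext fun t => pathFun_eq_sum p n ab t t.2
  rw [h]
  fun_prop

/-- The map `(a, b) ↦ Kl_{p^n}(·; (a, b))` with values in `C⁰([0,1], ℂ)`. -/
def path (p n : ℕ) [Fact p.Prime] (ab : (ZMod (p ^ n))ˣ × (ZMod (p ^ n))ˣ) :
    C(Set.Icc (0 : ℝ) 1, ℂ) :=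
  ⟨fun t => pathFun p n ab t, continuous_pathFun p n ab⟩

/-- `C⁰([0,1], ℂ)`, with the topology of the supremum norm, carries its Borel σ-algebra. -/
instance measurableSpace_paths : MeasurableSpace C(Set.Icc (0 : ℝ) 1, ℂ) := borel _

instance borelSpace_paths : BorelSpace C(Set.Icc (0 : ℝ) 1, ℂ) := ⟨rfl⟩

instance measurableSingletonClass_units (N : ℕ) : MeasurableSingletonClass (ZMod N)ˣ :=
  ⟨fun u => ⟨{(u : ZMod N)}, trivial, by ext v; simp [Units.ext_iff]⟩⟩

theorem measurable_path (p n : ℕ) [Fact p.Prime] : Measurable (path p n) :=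
  measurable_of_finite _

/-- The law of the random variable `Kl_{p^n}(·; (·, ·))`, the pairs `(a, b)` of units modulo
`p^n` being equipped with the uniform probability measure. -/
def law (p n : ℕ) [Fact p.Prime] : Measure C(Set.Icc (0 : ℝ) 1, ℂ) :=
  (uniformOn (Set.univ : Set ((ZMod (p ^ n))ˣ × (ZMod (p ^ n))ˣ))).map (path p n)

instance isProbabilityMeasure_law (p n : ℕ) [Fact p.Prime] :
    IsProbabilityMeasure (law p n) := by
  have : IsProbabilityMeasure
      (uniformOn (Set.univ : Set ((ZMod (p ^ n))ˣ × (ZMod (p ^ n))ˣ))) :=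
    isProbabilityMeasure_uniformOn Set.finite_univ Set.univ_nonempty
  exact Measure.isProbabilityMeasure_map (measurable_path p n).aemeasurable

end KloostermanPath

end

/-!
Tightness follows from Kolmogorov's criterion: the fourth moment of the increment of the path from
time `s` to time `t` is at most `432 (n + 1) (t - s) ^ 2`, uniformly in `p`.

The criterion (`isTightMeasureSet_of_lintegral_pow_four_le`) is proved by chaining. By Markov's
inequality and a union bound, outside an event of small probability all increments over dyadic
intervals of length `2 ^ (-m)` are bounded by `L * r ^ m`, for all `m` at once. The paths with this
property that start in a fixed ball have a common modulus of continuity, and they form a compact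
set by the Arzelà–Ascoli theorem (`isCompact_dyadicControlled`).

For the moment bound, let `q = p ^ n`. An increment is `q ^ (-1/2)` times a weighted sum of the
exponentials `e((a x + b x⁻¹) / q)`, where the weights lie in `[0,1]` and have sum
`T = (φ(q) - 1) (t - s)`. All terms being nonnegative, the sum over units `a, b` is at most the sum
over all residues, and Parseval's identity evaluates the latter as a weighted count of the solutions
of `x + y = z + w`, `x⁻¹ + y⁻¹ = z⁻¹ + w⁻¹` modulo `q` (`sum_norm_pow_four_eq`). Every solution
satisfies `q ∣ (x + y) (x - z) (y - z)`. Since `p` is odd and `x` is prime to `p`, one of the three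
factors is prime to `p`, hence `p ^ k` and `p ^ (n - k)` divide the other two for some `k`, which
puts two of the variables into residue classes determined by the third. In an interval of length
`H ≤ q` this leaves `O(n H ^ 2)` solutions (`card_le_of_pow_dvd`). The weights are supported on an
interval of length `O(T)` if `T ≥ 1`, and for `T ≤ 1` the trivial bound `T ^ 4` is good enough, so
the weighted count is `O(n T ^ 2)` in all cases (`weighted_count_le`). Dividing by the number
`φ(q) ^ 2` of pairs `(a, b)` gives the bound.
-/

noncomputable section

/-! ### Kolmogorov's tightness criterion -/

namespace KloostermanPath

open Filter Topology Set

/-- The dyadic point `k / 2 ^ m` of `[0,1]`; indices `k > 2 ^ m` are sent to `1`. -/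
def dyadic (m k : ℕ) : Icc (0 : ℝ) 1 := projIcc 0 1 zero_le_one ((k : ℝ) / 2 ^ m)

theorem coe_dyadic {m k : ℕ} (h : k ≤ 2 ^ m) : (dyadic m k : ℝ) = k / 2 ^ m := by
  have : (k : ℝ) ≤ 2 ^ m := by exact_mod_cast h
  rw [dyadic, projIcc_of_mem _ ⟨by positivity, div_le_one_of_le₀ this (by positivity)⟩]

theorem dyadic_succ_two_mul (m k : ℕ) : dyadic (m + 1) (2 * k) = dyadic m k := by
  unfold dyadic
  congr 1
  push_cast
  rw [pow_succ]
  field_simp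

/-- The number of the dyadic interval of level `m` that contains `t`. -/
def dyadicFloor (m : ℕ) (t : Icc (0 : ℝ) 1) : ℕ := ⌊2 ^ m * (t : ℝ)⌋₊

theorem dyadicFloor_le_two_pow (m : ℕ) (t : Icc (0 : ℝ) 1) : dyadicFloor m t ≤ 2 ^ m := by
  refine Nat.floor_le_of_le ?_
  have := t.2.2
  push_cast
  exact mul_le_of_le_one_right (by positivity) this

theorem dyadicFloor_le (m : ℕ) (t : Icc (0 : ℝ) 1) : (dyadicFloor m t : ℝ) ≤ 2 ^ m * t :=
  Nat.floor_le (mul_nonneg (by positivity) t.2.1)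

theorem lt_dyadicFloor_add_one (m : ℕ) (t : Icc (0 : ℝ) 1) :
    2 ^ m * (t : ℝ) < dyadicFloor m t + 1 := Nat.lt_floor_add_one _

theorem dyadicFloor_succ (m : ℕ) (t : Icc (0 : ℝ) 1) :
    dyadicFloor (m + 1) t = 2 * dyadicFloor m t ∨
      dyadicFloor (m + 1) t = 2 * dyadicFloor m t + 1 := by
  have h1 := dyadicFloor_le m t
  have h2 := lt_dyadicFloor_add_one m t
  have h3 := dyadicFloor_le (m + 1) t
  have h4 := lt_dyadicFloor_add_one (m + 1) t
  rw [pow_succ] at h3 h4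
  have h5 : dyadicFloor (m + 1) t < 2 * dyadicFloor m t + 2 := by
    have : (dyadicFloor (m + 1) t : ℝ) < 2 * dyadicFloor m t + 2 := by linarith
    exact_mod_cast this
  have h6 : 2 * dyadicFloor m t < dyadicFloor (m + 1) t + 1 := by
    have : 2 * (dyadicFloor m t : ℝ) < dyadicFloor (m + 1) t + 1 := by linarith
    exact_mod_cast this
  omega

theorem tendsto_dyadic_dyadicFloor (t : Icc (0 : ℝ) 1) :
    Tendsto (fun m => dyadic m (dyadicFloor m t)) atTop (𝓝 t) := by
  rw [tendsto_subtype_rng]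
  have h0 : Tendsto (fun m : ℕ => (t : ℝ) - (1 / 2) ^ m) atTop (𝓝 t) := by
    simpa using (tendsto_const_nhds (x := (t : ℝ))).sub
      (tendsto_pow_atTop_nhds_zero_of_lt_one (r := (1 / 2 : ℝ)) (by norm_num) (by norm_num))
  refine tendsto_of_tendsto_of_tendsto_of_le_of_le h0 tendsto_const_nhds (fun m => ?_)
    (fun m => ?_)
  · have := lt_dyadicFloor_add_one m t
    simp only [coe_dyadic (dyadicFloor_le_two_pow m t)]
    rw [one_div, inv_pow, sub_le_iff_le_add, ← one_div, ← add_div, le_div_iff₀ (by positivity)]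
    linarith
  · have := dyadicFloor_le m t
    simp only [coe_dyadic (dyadicFloor_le_two_pow m t)]
    rw [div_le_iff₀ (by positivity)]
    linarith

variable {E : Type*} [NormedAddCommGroup E]

/-- The continuous paths that start in the ball of radius `R` and whose increments over the
dyadic intervals of level `m` are bounded by `δ m`. -/
def dyadicControlled (R : ℝ) (δ : ℕ → ℝ) : Set C(Icc (0 : ℝ) 1, E) :=
  {f | ‖f 0‖ ≤ R ∧ ∀ m k, k < 2 ^ m → ‖f (dyadic m (k + 1)) - f (dyadic m k)‖ ≤ δ m}

theorem isClosed_dyadicControlled (R : ℝ) (δ : ℕ → ℝ) :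
    IsClosed (dyadicControlled R δ : Set C(Icc (0 : ℝ) 1, E)) := by
  simp only [dyadicControlled, ofPred_and, ofPred_forall]
  refine IsClosed.inter ?_ (isClosed_iInter fun m => isClosed_iInter fun k =>
    isClosed_iInter fun _ => ?_)
  · exact isClosed_le (by fun_prop) continuous_const
  · exact isClosed_le (by fun_prop) continuous_const

variable {R : ℝ} {δ : ℕ → ℝ} {f : C(Icc (0 : ℝ) 1, E)}

/-- Chaining: `t` is reached from its dyadic approximation of level `m` by at most one dyadic step
on each finer level. -/
theorem norm_sub_dyadic_le (hδ : ∀ m, 0 ≤ δ m) (hs : Summable δ) (hf : f ∈ dyadicControlled R δ)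
    (m : ℕ) (t : Icc (0 : ℝ) 1) :
    ‖f t - f (dyadic m (dyadicFloor m t))‖ ≤ ∑' i, δ (i + (m + 1)) := by
  have step : ∀ i, ‖f (dyadic (i + 1) (dyadicFloor (i + 1) t)) -
      f (dyadic i (dyadicFloor i t))‖ ≤ δ (i + 1) := by
    intro i
    have hle := dyadicFloor_le_two_pow (i + 1) t
    rw [← dyadic_succ_two_mul i]
    rcases dyadicFloor_succ i t with h | h
    · rw [h]
      simpa using hδ (i + 1)
    · rw [h] at hle ⊢
      exact hf.2 (i + 1) _ (by omega)
  have hs' : Summable fun i => δ (i + (m + 1)) := (summable_nat_add_iff (m + 1)).2 hs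
  have fin : ∀ j, ‖f (dyadic (j + m) (dyadicFloor (j + m) t)) -
      f (dyadic m (dyadicFloor m t))‖ ≤ ∑' i, δ (i + (m + 1)) := by
    intro j
    refine le_trans ?_ (hs'.sum_le_tsum (Finset.range j) fun i _ => hδ _)
    induction j with
    | zero => simp
    | succ j ih =>
      have h := step (j + m)
      rw [add_right_comm] at h
      rw [Finset.sum_range_succ, add_comm (∑ i ∈ _, _), ← add_assoc j m 1, add_right_comm j m 1]
      exact (norm_sub_le_norm_sub_add_norm_sub _
        (f (dyadic (j + m) (dyadicFloor (j + m) t))) _).trans (add_le_add h ih)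
  have lim : Tendsto (fun j => ‖f (dyadic (j + m) (dyadicFloor (j + m) t)) -
      f (dyadic m (dyadicFloor m t))‖) atTop (𝓝 ‖f t - f (dyadic m (dyadicFloor m t))‖) := by
    have h1 := (tendsto_dyadic_dyadicFloor t).comp (tendsto_add_atTop_nat m)
    exact ((f.continuous.tendsto t).comp h1 |>.sub_const _).norm
  exact le_of_tendsto' lim fin

theorem norm_sub_le_of_mem_dyadicControlled (hδ : ∀ m, 0 ≤ δ m) (hs : Summable δ)
    (hf : f ∈ dyadicControlled R δ) (m : ℕ) (s t : Icc (0 : ℝ) 1)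
    (hst : |(t : ℝ) - s| ≤ 1 / 2 ^ m) : ‖f t - f s‖ ≤ 2 * ∑' i, δ (i + m) := by
  wlog h : s ≤ t generalizing s t
  · rw [norm_sub_rev]
    exact this t s (by rwa [abs_sub_comm]) (le_of_not_ge h)
  have h' : (s : ℝ) ≤ t := h
  rw [abs_of_nonneg (by linarith), le_div_iff₀ (by positivity)] at hst
  have hmid : ‖f (dyadic m (dyadicFloor m t)) - f (dyadic m (dyadicFloor m s))‖ ≤ δ m := by
    have h1 : dyadicFloor m s ≤ dyadicFloor m t :=
      Nat.floor_mono (mul_le_mul_of_nonneg_left h' (by positivity))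
    have h2 : dyadicFloor m t ≤ dyadicFloor m s + 1 := by
      have a := dyadicFloor_le m t
      have b := lt_dyadicFloor_add_one m s
      have : (dyadicFloor m t : ℝ) < dyadicFloor m s + 1 + 1 := by nlinarith
      have : dyadicFloor m t < dyadicFloor m s + 1 + 1 := by exact_mod_cast this
      omega
    have h3 := dyadicFloor_le_two_pow m t
    rcases h1.eq_or_lt with h4 | h4
    · rw [h4]
      simpa using hδ m
    · rw [show dyadicFloor m t = dyadicFloor m s + 1 by omega] at h3 ⊢
      exact hf.2 m _ (by omega)
  have e : ∑' i, δ (i + m) = δ m + ∑' i, δ (i + (m + 1)) := by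
    rw [((summable_nat_add_iff m).2 hs).tsum_eq_zero_add]
    simp [add_assoc, add_comm 1]
  have a := norm_sub_dyadic_le hδ hs hf m t
  have b := norm_sub_dyadic_le hδ hs hf m s
  have c : f t - f s = (f t - f (dyadic m (dyadicFloor m t))) +
      (f (dyadic m (dyadicFloor m t)) - f (dyadic m (dyadicFloor m s))) -
      (f s - f (dyadic m (dyadicFloor m s))) := by abel
  rw [c]
  refine (norm_sub_le _ _).trans ?_
  have d := norm_add_le (f t - f (dyadic m (dyadicFloor m t)))
    (f (dyadic m (dyadicFloor m t)) - f (dyadic m (dyadicFloor m s)))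
  have := hδ m
  linarith

/-- Summable dyadic increments give a common modulus of continuity, so the Arzelà–Ascoli theorem
applies. -/
theorem isCompact_dyadicControlled [ProperSpace E] (hδ : ∀ m, 0 ≤ δ m) (hs : Summable δ) :
    IsCompact (dyadicControlled R δ : Set C(Icc (0 : ℝ) 1, E)) := by
  let e := ContinuousMap.isometryEquivBoundedOfCompact (Icc (0 : ℝ) 1) E
  have key : IsCompact (e.symm ⁻¹' (dyadicControlled R δ)) := by
    refine BoundedContinuousFunction.arzela_ascoli₂
      (Metric.closedBall (0 : E) (R + 2 * ∑' i, δ (i + 0))) (isCompact_closedBall _ _) _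
      ((isClosed_dyadicControlled R δ).preimage e.symm.continuous) ?_ ?_
    · intro f x hf
      have h1 := norm_sub_le_of_mem_dyadicControlled hδ hs hf 0 0 x (by
        simpa [abs_of_nonneg x.2.1] using x.2.2)
      have h2 := hf.1
      rw [mem_closedBall_zero_iff]
      have h3 : ‖f x‖ ≤ ‖f 0‖ + ‖f x - f 0‖ := by
        simpa using norm_add_le (f 0) (f x - f 0)
      exact h3.trans (add_le_add h2 h1)
    · intro t
      rw [Metric.equicontinuousAt_iff]
      intro ε hε
      have h0 : Tendsto (fun m => 2 * ∑' i, δ (i + m)) atTop (𝓝 0) := by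
        simpa using (tendsto_sum_nat_add δ).const_mul 2
      obtain ⟨m, hm⟩ := ((tendsto_order.1 h0).2 ε hε).exists
      refine ⟨1 / 2 ^ m, by positivity, fun s hst f => ?_⟩
      rw [dist_comm, dist_eq_norm]
      rw [Subtype.dist_eq, Real.dist_eq] at hst
      exact (norm_sub_le_of_mem_dyadicControlled hδ hs f.2 m t s hst.le).trans_lt hm
  have := key.image e.symm.continuous
  rwa [image_preimage_eq _ e.symm.surjective] at this

/-- Kolmogorov's tightness criterion, with fourth moments: it suffices that the increments satisfy
`𝔼 ‖X t - X s‖ ^ 4 ≤ C * (t - s) ^ 2` and that the starting points stay bounded. -/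
theorem isTightMeasureSet_of_lintegral_pow_four_le [ProperSpace E]
    [MeasurableSpace C(Icc (0 : ℝ) 1, E)] [BorelSpace C(Icc (0 : ℝ) 1, E)]
    {S : Set (Measure C(Icc (0 : ℝ) 1, E))} {C R : ℝ} (hC : 0 ≤ C)
    (h0 : ∀ μ ∈ S, ∀ᵐ f ∂μ, ‖f 0‖ ≤ R)
    (hS : ∀ μ ∈ S, ∀ s t : Icc (0 : ℝ) 1, s ≤ t →
      ∫⁻ f, ENNReal.ofReal (‖f t - f s‖ ^ 4) ∂μ ≤ ENNReal.ofReal (C * ((t : ℝ) - s) ^ 2)) :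
    IsTightMeasureSet S := by
  rw [isTightMeasureSet_iff_exists_isCompact_measure_compl_le]
  intro ε hε
  -- `r` is chosen with `1 / 2 < r ^ 4` and `r < 1`, so that both `∑ r ^ m` and
  -- `∑ 2 ^ m * (2 ^ (-m)) ^ 2 / (r ^ m) ^ 4` converge.
  set r : ℝ := 9 / 10 with hr
  set ρ : ℝ := 1 / (2 * r ^ 4) with hρ
  have hρ0 : 0 ≤ ρ := by rw [hρ, hr]; norm_num
  have hρ1 : ρ < 1 := by rw [hρ, hr]; norm_num
  have hlim : Tendsto (fun L : ℝ => ENNReal.ofReal (C * (1 - ρ)⁻¹ / L ^ 4)) atTop (𝓝 0) := by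
    have := tendsto_const_nhds (x := C * (1 - ρ)⁻¹) (f := (atTop : Filter ℝ)) |>.div_atTop
      (tendsto_pow_atTop (α := ℝ) (n := 4) (by norm_num))
    simpa using ENNReal.tendsto_ofReal this
  obtain ⟨L, hL, hL0⟩ := (((tendsto_order.1 hlim).2 ε hε).and (eventually_gt_atTop 0)).exists
  have hr0 : 0 < r := by rw [hr]; norm_num
  refine ⟨dyadicControlled R fun m => L * r ^ m, isCompact_dyadicControlled
    (fun m => by positivity) ((summable_geometric_of_lt_one hr0.le (by rw [hr]; norm_num)).mul_left
      L), fun μ hμ => ?_⟩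
  have one : ∀ m k : ℕ, k < 2 ^ m →
      μ {f | L * r ^ m < ‖f (dyadic m (k + 1)) - f (dyadic m k)‖} ≤
        ENNReal.ofReal (C * (1 / 2 ^ m) ^ 2 / (L * r ^ m) ^ 4) := by
    intro m k hk
    have hpos : 0 < (L * r ^ m) ^ 4 := by positivity
    have hd : (dyadic m (k + 1) : ℝ) - dyadic m k = 1 / 2 ^ m := by
      rw [coe_dyadic hk.le, coe_dyadic hk]
      push_cast
      ring
    have hle : dyadic m k ≤ dyadic m (k + 1) := by
      rw [← Subtype.coe_le_coe, ← sub_nonneg, hd]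
      positivity
    rw [ENNReal.ofReal_div_of_pos hpos, ← hd]
    refine le_trans ?_ (ENNReal.div_le_div_right (hS μ hμ _ _ hle) _)
    refine (measure_mono ?_).trans (meas_ge_le_lintegral_div (μ := μ)
      (f := fun f : C(Icc (0 : ℝ) 1, E) =>
        ENNReal.ofReal (‖f (dyadic m (k + 1)) - f (dyadic m k)‖ ^ 4)) ?_ ?_ ENNReal.ofReal_ne_top)
    · intro f hf
      exact ENNReal.ofReal_le_ofReal (pow_le_pow_left₀ (by positivity) (le_of_lt hf) 4)
    · exact (ENNReal.continuous_ofReal.comp (by fun_prop)).aemeasurable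
    · simpa using hpos
  have sub : (dyadicControlled R fun m => L * r ^ m : Set C(Icc (0 : ℝ) 1, E))ᶜ ⊆
      {f | ¬ ‖f 0‖ ≤ R} ∪ ⋃ m, ⋃ k ∈ Finset.range (2 ^ m),
        {f | L * r ^ m < ‖f (dyadic m (k + 1)) - f (dyadic m k)‖} := by
    intro f hf
    simp only [dyadicControlled, mem_compl_iff, mem_ofPred_eq, not_and_or, not_forall,
      not_le] at hf
    rcases hf with hf | ⟨m, k, hk, hf⟩
    · exact Or.inl (not_le.2 hf)
    · refine Or.inr (mem_iUnion.2 ⟨m, mem_iUnion₂.2 ⟨k, Finset.mem_range.2 hk, hf⟩⟩)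
  calc μ _ ≤ _ := measure_mono sub
    _ ≤ _ := measure_union_le _ _
    _ ≤ 0 + ∑' m, ∑ k ∈ Finset.range (2 ^ m),
        μ {f | L * r ^ m < ‖f (dyadic m (k + 1)) - f (dyadic m k)‖} := by
      refine add_le_add (h0 μ hμ).le ((measure_iUnion_le _).trans ?_)
      exact ENNReal.tsum_le_tsum fun m => measure_biUnion_finset_le _ _
    _ ≤ ∑' m, ENNReal.ofReal (C / L ^ 4 * ρ ^ m) := by
      rw [zero_add]
      refine ENNReal.tsum_le_tsum fun m => ?_
      refine (Finset.sum_le_sum fun k hk => one m k (Finset.mem_range.1 hk)).trans ?_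
      rw [Finset.sum_const, Finset.card_range, nsmul_eq_mul, ← ENNReal.ofReal_natCast,
        ← ENNReal.ofReal_mul (by positivity)]
      refine le_of_eq (congrArg _ ?_)
      rw [hρ]
      push_cast
      rw [div_pow 1 (2 * r ^ 4) m, mul_pow L, mul_pow 2, ← pow_mul r m, mul_comm m 4,
        pow_mul r 4 m, one_pow]
      field_simp
    _ = ENNReal.ofReal (C * (1 - ρ)⁻¹ / L ^ 4) := by
      rw [← ENNReal.ofReal_tsum_of_nonneg (fun m => by positivity)
        ((summable_geometric_of_lt_one hρ0 hρ1).mul_left _), tsum_mul_left,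
        tsum_geometric_of_lt_one hρ0 hρ1]
      congr 1
      ring
    _ ≤ ε := hL.le

end KloostermanPath

/-! ### Counting solutions of congruences in short intervals -/

namespace KloostermanPath

open Finset

theorem card_Ico_filter_modEq_le (m v : ℤ) (H : ℕ) {r : ℕ} (hr : 0 < r) :
    #{x ∈ Ico m (m + H) | x ≡ v [ZMOD r]} ≤ H / r + 1 := by
  have hrZ : (0 : ℤ) < r := by exact_mod_cast hr
  have key : (#{x ∈ Ico m (m + H) | x ≡ v [ZMOD r]} : ℤ) ≤ ((H / r + 1 : ℕ) : ℤ) := by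
    rw [Int.Ico_filter_modEq_card _ _ hrZ, max_le_iff]
    refine ⟨?_, by positivity⟩
    rw [sub_le_iff_le_add, Int.ceil_le]
    have h1 := Int.le_ceil (((m : ℚ) - v) / ((r : ℤ) : ℚ))
    have h2 : (H : ℚ) / r ≤ ((H / r : ℕ) : ℚ) + 1 := by
      have : H < r * (H / r + 1) := Nat.lt_mul_div_succ H hr
      rw [div_le_iff₀ (by exact_mod_cast hr)]
      have : (H : ℚ) < r * ((H / r : ℕ) + 1) := by exact_mod_cast this
      linarith
    have h3 : (((m + H : ℤ) : ℚ) - v) / ((r : ℤ) : ℚ)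
        = ((m : ℚ) - v) / ((r : ℤ) : ℚ) + (H : ℚ) / r := by
      push_cast
      ring
    rw [h3]
    simp only [Int.cast_add, Int.cast_one, Int.cast_natCast, Nat.cast_add, Nat.cast_one] at h1 h2 ⊢
    linarith
  exact_mod_cast key

/-- Triples of integers from an interval of length `H`, the second and the third of which lie in
residue classes determined by the first. -/
theorem card_le_of_modEq_of_modEq {τ : Type*} {T : Finset τ} {c u v : τ → ℤ} {m : ℤ} {H P Q : ℕ}
    (hP : 0 < P) (hQ : 0 < Q) (f g : ℤ → ℤ)
    (inj : ∀ s ∈ T, ∀ t ∈ T, c s = c t → u s = u t → v s = v t → s = t)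
    (hc : ∀ t ∈ T, c t ∈ Ico m (m + H)) (hu : ∀ t ∈ T, u t ∈ Ico m (m + H))
    (hv : ∀ t ∈ T, v t ∈ Ico m (m + H))
    (huf : ∀ t ∈ T, u t ≡ f (c t) [ZMOD P]) (hvg : ∀ t ∈ T, v t ≡ g (c t) [ZMOD Q]) :
    #T ≤ (H / P + 1) * (H / Q + 1) * H := by
  have hcard : #(Ico m (m + H)) = H := by simp
  rw [← hcard]
  nth_rewrite 1 2 [hcard]
  classical
  refine card_le_mul_card_image_of_maps_to hc _ fun b _ => ?_
  refine le_trans ?_ (Nat.mul_le_mul (card_Ico_filter_modEq_le m (f b) H hP)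
    (card_Ico_filter_modEq_le m (g b) H hQ))
  rw [← card_product]
  refine card_le_card_of_injOn (fun t => (u t, v t)) ?_ ?_
  · intro t ht
    simp only [coe_filter, Set.mem_ofPred_eq] at ht
    obtain ⟨ht, rfl⟩ := ht
    simpa using ⟨⟨mem_Ico.1 (hu t ht), huf t ht⟩, mem_Ico.1 (hv t ht), hvg t ht⟩
  · intro s hs t ht hst
    simp only [coe_filter, Set.mem_ofPred_eq] at hs ht
    simp only [Prod.mk.injEq] at hst
    exact inj s hs.1 t ht.1 (hs.2.trans ht.2.symm) hst.1 hst.2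

/-- Two residue classes, modulo `P` and modulo `Q`, together meet an interval of length
`H ≤ P * Q` in `O(H)` pairs. -/
theorem div_add_one_mul_div_add_one_le {H P Q : ℕ} (hP : 0 < P) (hQ : 0 < Q) (hH : 0 < H)
    (h : H ≤ P * Q) : (H / P + 1) * (H / Q + 1) ≤ 4 * H := by
  have h1 : H / P ≤ H := Nat.div_le_self _ _
  have h2 : H / Q ≤ H := Nat.div_le_self _ _
  have h3 : (H / P) * (H / Q) ≤ H := by
    have a : H / P * P ≤ H := Nat.div_mul_le_self _ _
    have b : H / Q * Q ≤ H := Nat.div_mul_le_self _ _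
    have e := Nat.mul_le_mul a b
    have e2 : (H / P) * (H / Q) * (P * Q) ≤ H * (P * Q) := by
      calc _ = H / P * P * (H / Q * Q) := by ring
        _ ≤ H * H := e
        _ ≤ _ := Nat.mul_le_mul_left _ h
    exact Nat.le_of_mul_le_mul_right e2 (by positivity)
  nlinarith

/-- A prime power dividing a product divides it factor by factor. -/
theorem exists_pow_dvd_and_pow_dvd {p n : ℕ} (hp : p.Prime) {u v : ℤ}
    (h : ((p ^ n : ℕ) : ℤ) ∣ u * v) :
    ∃ k ∈ range (n + 1), ((p ^ k : ℕ) : ℤ) ∣ u ∧ ((p ^ (n - k) : ℕ) : ℤ) ∣ v := by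
  rw [Int.natCast_dvd, Int.natAbs_mul] at h
  obtain ⟨d, e, hd, he, hde⟩ := exists_dvd_and_dvd_of_dvd_mul h
  obtain ⟨k, hk, rfl⟩ := (Nat.dvd_prime_pow hp).1 ⟨e, hde⟩
  have : e = p ^ (n - k) := by
    refine Nat.eq_of_mul_eq_mul_left (pow_pos hp.pos k) ?_
    rw [← hde, ← pow_add, Nat.add_sub_cancel' hk]
  exact ⟨k, mem_range.2 (by omega), Int.natCast_dvd.2 hd, Int.natCast_dvd.2 (this ▸ he)⟩

/-- Three factors `x + y`, `x - z`, `y - z` cannot all be divisible by the odd prime `p` when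
`p ∤ x`, so `p ^ n` divides a product of two of them. -/
theorem exists_pow_dvd_pairs {p n : ℕ} (hp : p.Prime) (h2 : p ≠ 2) {x y z : ℤ}
    (hx : ¬ (p : ℤ) ∣ x) (h : ((p ^ n : ℕ) : ℤ) ∣ (x + y) * (x - z) * (y - z)) :
    ∃ k ∈ range (n + 1),
      (((p ^ k : ℕ) : ℤ) ∣ x + y ∧ ((p ^ (n - k) : ℕ) : ℤ) ∣ x - z) ∨
      (((p ^ k : ℕ) : ℤ) ∣ x + y ∧ ((p ^ (n - k) : ℕ) : ℤ) ∣ y - z) ∨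
      (((p ^ k : ℕ) : ℤ) ∣ x - z ∧ ((p ^ (n - k) : ℕ) : ℤ) ∣ y - z) := by
  have hpZ : Prime (p : ℤ) := Nat.prime_iff_prime_int.1 hp
  have cop : ∀ w : ℤ, ¬ (p : ℤ) ∣ w → IsCoprime ((p ^ n : ℕ) : ℤ) w := fun w hw => by
    push_cast
    exact ((hpZ.irreducible.coprime_iff_not_dvd).2 hw).pow_left
  by_cases h1 : (p : ℤ) ∣ y - z
  · by_cases h3 : (p : ℤ) ∣ x - z
    · have h4 : ¬ (p : ℤ) ∣ x + y := fun h4 => by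
        have h5 : (p : ℤ) ∣ 2 * x := by
          have := dvd_sub (dvd_add h4 h3) h1
          rwa [show x + y + (x - z) - (y - z) = 2 * x by ring] at this
        rcases hpZ.dvd_or_dvd h5 with h6 | h6
        · exact h2 ((Nat.prime_dvd_prime_iff_eq hp Nat.prime_two).1 (by exact_mod_cast h6))
        · exact hx h6
      rw [mul_assoc] at h
      obtain ⟨k, hk, a, b⟩ := exists_pow_dvd_and_pow_dvd hp ((cop _ h4).dvd_of_dvd_mul_left h)
      exact ⟨k, hk, Or.inr (Or.inr ⟨a, b⟩)⟩
    · rw [mul_right_comm] at h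
      obtain ⟨k, hk, a, b⟩ := exists_pow_dvd_and_pow_dvd hp ((cop _ h3).dvd_of_dvd_mul_right h)
      exact ⟨k, hk, Or.inr (Or.inl ⟨a, b⟩)⟩
  · obtain ⟨k, hk, a, b⟩ := exists_pow_dvd_and_pow_dvd hp ((cop _ h1).dvd_of_dvd_mul_right h)
    exact ⟨k, hk, Or.inl ⟨a, b⟩⟩

/-- Up to a factor depending only on `n`, the solutions of `p ^ n ∣ (x + y) * (x - z) * (y - z)` in
an interval of length `H ≤ p ^ n` are no more numerous than the diagonal ones, `H ^ 2`. The
solutions are parametrized by a finite set `T` on which `(x, y, z)` is injective. -/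
theorem card_le_of_pow_dvd {τ : Type*} {T : Finset τ} {x y z : τ → ℤ} {m : ℤ} {H p n : ℕ}
    (hp : p.Prime) (h2 : p ≠ 2) (hH : 0 < H) (hHq : H ≤ p ^ n)
    (inj : ∀ s ∈ T, ∀ t ∈ T, x s = x t → y s = y t → z s = z t → s = t)
    (hx : ∀ t ∈ T, x t ∈ Ico m (m + H)) (hy : ∀ t ∈ T, y t ∈ Ico m (m + H))
    (hz : ∀ t ∈ T, z t ∈ Ico m (m + H)) (hpx : ∀ t ∈ T, ¬ (p : ℤ) ∣ x t)
    (h : ∀ t ∈ T, ((p ^ n : ℕ) : ℤ) ∣ (x t + y t) * (x t - z t) * (y t - z t)) :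
    #T ≤ 12 * (n + 1) * H ^ 2 := by
  classical
  let T₁ (k : ℕ) : Finset τ :=
    {t ∈ T | ((p ^ k : ℕ) : ℤ) ∣ x t + y t ∧ ((p ^ (n - k) : ℕ) : ℤ) ∣ x t - z t}
  let T₂ (k : ℕ) : Finset τ :=
    {t ∈ T | ((p ^ k : ℕ) : ℤ) ∣ x t + y t ∧ ((p ^ (n - k) : ℕ) : ℤ) ∣ y t - z t}
  let T₃ (k : ℕ) : Finset τ :=
    {t ∈ T | ((p ^ k : ℕ) : ℤ) ∣ x t - z t ∧ ((p ^ (n - k) : ℕ) : ℤ) ∣ y t - z t}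
  have sub : T ⊆ (range (n + 1)).biUnion fun k => T₁ k ∪ (T₂ k ∪ T₃ k) := by
    intro t ht
    obtain ⟨k, hk, hk'⟩ := exists_pow_dvd_pairs hp h2 (hpx t ht) (h t ht)
    simp only [mem_biUnion, mem_union, T₁, T₂, T₃, mem_filter, ht, true_and]
    exact ⟨k, hk, hk'⟩
  have hpos : ∀ k, 0 < p ^ k := fun k => pow_pos hp.pos k
  have bound : ∀ k ∈ range (n + 1),
      (H / p ^ k + 1) * (H / p ^ (n - k) + 1) * H ≤ 4 * H ^ 2 := fun k hk => by
    have hq : H ≤ p ^ k * p ^ (n - k) := by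
      rwa [← pow_add, Nat.add_sub_cancel' (by have := mem_range.1 hk; omega)]
    calc _ ≤ 4 * H * H :=
          Nat.mul_le_mul_right _ (div_add_one_mul_div_add_one_le (hpos _) (hpos _) hH hq)
      _ = _ := by ring
  have c₁ : ∀ k, #(T₁ k) ≤ (H / p ^ k + 1) * (H / p ^ (n - k) + 1) * H := fun k => by
    refine card_le_of_modEq_of_modEq (c := x) (u := y) (v := z) (hpos _) (hpos _)
      (fun w => -w) (fun w => w)
      (fun s hs t ht => inj s (mem_filter.1 hs).1 t (mem_filter.1 ht).1)
      (fun t ht => hx t (mem_filter.1 ht).1) (fun t ht => hy t (mem_filter.1 ht).1)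
      (fun t ht => hz t (mem_filter.1 ht).1) (fun t ht => ?_) (fun t ht => ?_)
    · exact (Int.modEq_iff_dvd.2 (by simpa [add_comm] using (mem_filter.1 ht).2.1)).symm
    · exact Int.modEq_iff_dvd.2 (mem_filter.1 ht).2.2
  have c₂ : ∀ k, #(T₂ k) ≤ (H / p ^ k + 1) * (H / p ^ (n - k) + 1) * H := fun k => by
    refine card_le_of_modEq_of_modEq (c := y) (u := x) (v := z) (hpos _) (hpos _)
      (fun w => -w) (fun w => w)
      (fun s hs t ht a b => inj s (mem_filter.1 hs).1 t (mem_filter.1 ht).1 b a)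
      (fun t ht => hy t (mem_filter.1 ht).1) (fun t ht => hx t (mem_filter.1 ht).1)
      (fun t ht => hz t (mem_filter.1 ht).1) (fun t ht => ?_) (fun t ht => ?_)
    · exact (Int.modEq_iff_dvd.2 (by simpa using (mem_filter.1 ht).2.1)).symm
    · exact Int.modEq_iff_dvd.2 (mem_filter.1 ht).2.2
  have c₃ : ∀ k, #(T₃ k) ≤ (H / p ^ k + 1) * (H / p ^ (n - k) + 1) * H := fun k => by
    refine card_le_of_modEq_of_modEq (c := z) (u := x) (v := y) (hpos _) (hpos _)
      (fun w => w) (fun w => w)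
      (fun s hs t ht a b c => inj s (mem_filter.1 hs).1 t (mem_filter.1 ht).1 b c a)
      (fun t ht => hz t (mem_filter.1 ht).1) (fun t ht => hx t (mem_filter.1 ht).1)
      (fun t ht => hy t (mem_filter.1 ht).1) (fun t ht => ?_) (fun t ht => ?_)
    · exact (Int.modEq_iff_dvd.2 (mem_filter.1 ht).2.1).symm
    · exact (Int.modEq_iff_dvd.2 (mem_filter.1 ht).2.2).symm
  calc #T ≤ _ := card_le_card sub
    _ ≤ #(range (n + 1)) * (12 * H ^ 2) := by
      refine card_biUnion_le_card_mul _ _ _ fun k hk => ?_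
      have b := bound k hk
      have u₁ := card_union_le (T₁ k) (T₂ k ∪ T₃ k)
      have u₂ := card_union_le (T₂ k) (T₃ k)
      have := c₁ k
      have := c₂ k
      have := c₃ k
      omega
    _ = _ := by
      rw [card_range]
      ring

/-- Two pairs of units with the same sum and the same sum of inverses also have the same product,
up to the factor `x + y`, and `z` is a root of `(X - x) * (X - y)` up to that factor. -/
theorem mul_sub_mul_sub_eq_zero {R : Type*} [CommRing R] {x y z w x' y' z' w' : R}
    (hx : x * x' = 1) (hy : y * y' = 1) (hz : z * z' = 1) (hw : w * w' = 1)
    (h : x + y = z + w) (h' : x' + y' = z' + w') : (x + y) * (x - z) * (y - z) = 0 := by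
  have a : x * y * (x' + y') = x + y := by linear_combination y * hx + x * hy
  have b : z * w * (z' + w') = z + w := by linear_combination w * hz + z * hw
  -- both `s * z * w` and `s * x * y` equal `x * y * z * w * (x' + y')`, where `s = x + y`
  have e : (x + y) * (z * w) = (x + y) * (x * y) := by
    linear_combination (-(z * w)) * a + (x * y) * b - x * y * h + (x * y * z * w) * h'
  have hw' : w = x + y - z := by linear_combination -h
  subst hw'
  linear_combination -e

end KloostermanPath

/-! ### Fourth moments of exponential sums modulo `p ^ n` -/

namespace KloostermanPath

open Finset
open scoped ComplexConjugate

theorem sum_stdAddChar_mul {q : ℕ} [NeZero q] (u : ZMod q) :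
    ∑ a : ZMod q, ZMod.stdAddChar (a * u) = if u = 0 then (q : ℂ) else 0 := by
  rw [AddChar.sum_mulShift _ (ZMod.isPrimitive_stdAddChar q), ZMod.card]
  split_ifs <;> simp

/-- Parseval's identity on `(ℤ/qℤ)²`. -/
theorem sum_norm_sq_eq {q : ℕ} [NeZero q] {κ : Type*} (K : Finset κ) (w : κ → ℝ)
    (u v : κ → ZMod q) :
    ∑ ab : ZMod q × ZMod q,
      ‖∑ k ∈ K, (w k : ℂ) * ZMod.stdAddChar (ab.1 * u k + ab.2 * v k)‖ ^ 2 =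
    q ^ 2 * ∑ k ∈ K, ∑ l ∈ K, if u k = u l ∧ v k = v l then w k * w l else 0 := by
  have e : ∀ ab : ZMod q × ZMod q,
      (‖∑ k ∈ K, (w k : ℂ) * ZMod.stdAddChar (ab.1 * u k + ab.2 * v k)‖ ^ 2 : ℂ) =
      ∑ k ∈ K, ∑ l ∈ K, (w k * w l : ℂ) *
        (ZMod.stdAddChar (ab.1 * (u k - u l)) * ZMod.stdAddChar (ab.2 * (v k - v l))) := by
    intro ab
    rw [← Complex.mul_conj', map_sum, sum_mul_sum]
    refine sum_congr rfl fun k _ => sum_congr rfl fun l _ => ?_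
    rw [map_mul, Complex.conj_ofReal, ← AddChar.map_neg_eq_conj, mul_mul_mul_comm,
      ← AddChar.map_add_eq_mul, ← AddChar.map_add_eq_mul]
    congr 2
    ring
  have h : ((∑ ab : ZMod q × ZMod q,
      ‖∑ k ∈ K, (w k : ℂ) * ZMod.stdAddChar (ab.1 * u k + ab.2 * v k)‖ ^ 2 : ℝ) : ℂ) =
      ((q ^ 2 * ∑ k ∈ K, ∑ l ∈ K, if u k = u l ∧ v k = v l then w k * w l else 0 : ℝ) : ℂ) := by
    push_cast
    simp only [e]
    rw [sum_comm, mul_sum]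
    refine sum_congr rfl fun k _ => ?_
    rw [sum_comm, mul_sum]
    refine sum_congr rfl fun l _ => ?_
    rw [← mul_sum, Fintype.sum_prod_type]
    simp only [← mul_sum, ← sum_mul, sum_stdAddChar_mul, sub_eq_zero]
    by_cases h1 : u k = u l <;> by_cases h2 : v k = v l <;> simp [h1, h2]
    ring
  exact_mod_cast h

/-- The fourth moment of a weighted exponential sum counts, with weights, the solutions of a
system of two linear equations. -/
theorem sum_norm_pow_four_eq {q : ℕ} [NeZero q] {ι : Type*} (S : Finset ι) (c : ι → ℝ)
    (x y : ι → ZMod q) :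
    ∑ ab : ZMod q × ZMod q,
      ‖∑ i ∈ S, (c i : ℂ) * ZMod.stdAddChar (ab.1 * x i + ab.2 * y i)‖ ^ 4 =
    q ^ 2 * ∑ k ∈ S ×ˢ S, ∑ l ∈ S ×ˢ S,
      if x k.1 + x k.2 = x l.1 + x l.2 ∧ y k.1 + y k.2 = y l.1 + y l.2 then
        c k.1 * c k.2 * (c l.1 * c l.2) else 0 := by
  rw [← sum_norm_sq_eq (S ×ˢ S) (fun k => c k.1 * c k.2) (fun k => x k.1 + x k.2)
    (fun k => y k.1 + y k.2)]
  refine sum_congr rfl fun ab _ => ?_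
  rw [show 4 = 2 * 2 from rfl, pow_mul, ← norm_pow, sq (∑ i ∈ S, _), sum_mul_sum, sum_product]
  congr 2
  refine sum_congr rfl fun i _ => sum_congr rfl fun j _ => ?_
  rw [mul_mul_mul_comm, ← AddChar.map_add_eq_mul]
  push_cast
  congr 2
  ring

/-- The integers `x i` are prime to `p`, with inverses `y i` modulo `p ^ n`, and carry weights
`c i` of sum `T`. If they lie in an interval of length `H`, where `H ≤ 6 * T` unless `T < 1`, then
the weighted number of solutions is at most a constant times `T ^ 2`. -/
theorem weighted_count_le {p n : ℕ} (hp : p.Prime) (h2 : p ≠ 2) {ι : Type*} (S : Finset ι)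
    (c : ι → ℝ) (x : ι → ℤ) (y : ι → ZMod (p ^ n)) {T : ℝ} {m : ℤ} {H : ℕ}
    (hc0 : ∀ i ∈ S, 0 ≤ c i) (hc1 : ∀ i ∈ S, c i ≤ 1) (hT : ∑ i ∈ S, c i = T)
    (hH : 0 < H) (hHq : H ≤ p ^ n) (hHT : 1 ≤ T → (H : ℝ) ≤ 6 * T)
    (inj : Set.InjOn x S) (hx : ∀ i ∈ S, x i ∈ Ico m (m + H))
    (hpx : ∀ i ∈ S, ¬ (p : ℤ) ∣ x i) (hxy : ∀ i ∈ S, ((x i : ℤ) : ZMod (p ^ n)) * y i = 1) :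
    (∑ k ∈ S ×ˢ S, ∑ l ∈ S ×ˢ S,
      if ((x k.1 : ℤ) : ZMod (p ^ n)) + (x k.2 : ℤ) = (x l.1 : ℤ) + (x l.2 : ℤ) ∧
          y k.1 + y k.2 = y l.1 + y l.2 then
        c k.1 * c k.2 * (c l.1 * c l.2) else 0) ≤ 432 * (n + 1) * T ^ 2 := by
  have hT0 : 0 ≤ T := hT ▸ sum_nonneg hc0
  rcases le_total T 1 with hT1 | hT1
  · -- a total weight at most `1` makes the trivial bound `T ^ 4` sufficient
    calc _ ≤ ∑ k ∈ S ×ˢ S, ∑ l ∈ S ×ˢ S, c k.1 * c k.2 * (c l.1 * c l.2) := by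
          refine sum_le_sum fun k hk => sum_le_sum fun l hl => ?_
          rw [mem_product] at hk hl
          split_ifs
          · exact le_rfl
          · exact mul_nonneg (mul_nonneg (hc0 _ hk.1) (hc0 _ hk.2))
              (mul_nonneg (hc0 _ hl.1) (hc0 _ hl.2))
      _ = T ^ 4 := by
          simp only [← mul_sum, ← sum_mul, sum_product, hT]
          ring
      _ ≤ 1 * T ^ 2 := by
          rw [one_mul]
          exact pow_le_pow_of_le_one hT0 hT1 (by norm_num)
      _ ≤ _ := by
          gcongr
          have : (0 : ℝ) ≤ n := by positivity
          linarith
  · classical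
    set Q : Finset ((ι × ι) × (ι × ι)) := {kl ∈ (S ×ˢ S) ×ˢ (S ×ˢ S) |
      ((x kl.1.1 : ℤ) : ZMod (p ^ n)) + (x kl.1.2 : ℤ) = (x kl.2.1 : ℤ) + (x kl.2.2 : ℤ) ∧
          y kl.1.1 + y kl.1.2 = y kl.2.1 + y kl.2.2} with hQ
    have hmem : ∀ t ∈ Q, (t.1.1 ∈ S ∧ t.1.2 ∈ S ∧ t.2.1 ∈ S ∧ t.2.2 ∈ S) ∧
        ((x t.1.1 : ℤ) : ZMod (p ^ n)) + (x t.1.2 : ℤ) = (x t.2.1 : ℤ) + (x t.2.2 : ℤ) ∧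
          y t.1.1 + y t.1.2 = y t.2.1 + y t.2.2 := by
      intro t ht
      simp only [hQ, mem_filter, mem_product] at ht
      tauto
    have card : #Q ≤ 12 * (n + 1) * H ^ 2 := by
      refine card_le_of_pow_dvd (x := fun t => x t.1.1) (y := fun t => x t.1.2)
        (z := fun t => x t.2.1) (m := m) hp h2 hH hHq ?_
        (fun t ht => hx _ (hmem t ht).1.1) (fun t ht => hx _ (hmem t ht).1.2.1)
        (fun t ht => hx _ (hmem t ht).1.2.2.1) (fun t ht => hpx _ (hmem t ht).1.1) ?_
      · rintro ⟨⟨s₁, s₂⟩, s₃, s₄⟩ hs ⟨⟨t₁, t₂⟩, t₃, t₄⟩ ht h₁ h₂ h₃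
        obtain ⟨⟨a₁, a₂, a₃, a₄⟩, ha, -⟩ := hmem _ hs
        obtain ⟨⟨b₁, b₂, b₃, b₄⟩, hb, -⟩ := hmem _ ht
        dsimp only at *
        rw [h₁, h₂, hb, h₃] at ha
        -- the fourth integer is known modulo `p ^ n`, and the interval is not longer than that
        have h₄ : x s₄ = x t₄ := by
          have h := (ZMod.intCast_eq_intCast_iff_dvd_sub _ _ _).1 (add_left_cancel ha)
          have hs := mem_Ico.1 (hx _ a₄)
          have ht := mem_Ico.1 (hx _ b₄)
          have hHq' : (H : ℤ) ≤ ((p ^ n : ℕ) : ℤ) := by exact_mod_cast hHq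
          have := Int.eq_zero_of_abs_lt_dvd h (by rw [abs_lt]; constructor <;> linarith)
          linarith
        rw [inj a₁ b₁ h₁, inj a₂ b₂ h₂, inj a₃ b₃ h₃, inj a₄ b₄ h₄]
      · intro t ht
        obtain ⟨⟨a₁, a₂, a₃, a₄⟩, hs, hi⟩ := hmem t ht
        rw [← ZMod.intCast_zmod_eq_zero_iff_dvd]
        push_cast
        exact mul_sub_mul_sub_eq_zero (hxy _ a₁) (hxy _ a₂) (hxy _ a₃) (hxy _ a₄) hs hi
    calc _ = ∑ kl ∈ Q, c kl.1.1 * c kl.1.2 * (c kl.2.1 * c kl.2.2) := by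
          rw [hQ, sum_filter, sum_product (S ×ˢ S) (S ×ˢ S)]
      _ ≤ ∑ kl ∈ Q, (1 : ℝ) := by
          refine sum_le_sum fun t ht => ?_
          obtain ⟨⟨a₁, a₂, a₃, a₄⟩, -⟩ := hmem t ht
          exact mul_le_one₀ (mul_le_one₀ (hc1 _ a₁) (hc0 _ a₂) (hc1 _ a₂))
            (mul_nonneg (hc0 _ a₃) (hc0 _ a₄)) (mul_le_one₀ (hc1 _ a₃) (hc0 _ a₄) (hc1 _ a₄))
      _ = #Q := by simp
      _ ≤ 12 * (n + 1) * (H : ℝ) ^ 2 := by exact_mod_cast card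
      _ ≤ 12 * (n + 1) * (6 * T) ^ 2 := by
          gcongr
          exact hHT hT1
      _ = _ := by ring

end KloostermanPath

/-! ### Increments of Kloosterman paths -/

namespace KloostermanPath

open Finset

theorem index_succ (p e : ℕ) {r : ℕ} (hr : r < p - 1) :
    index p ((p - 1) * e + r + 1) = p * e + r + 1 := by
  obtain ⟨d, rfl⟩ : ∃ d, p = d + 1 := ⟨p - 1, by omega⟩
  simp only [Nat.add_sub_cancel] at hr
  simp only [index, Nat.add_sub_cancel]
  rw [Nat.mul_add_div (by omega), Nat.div_eq_of_lt hr]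
  ring

/-- Euclidean division of `j - 1` by `p - 1`, which determines the `j`-th integer prime to `p`. -/
theorem exists_eq_mul_add_add_one {p j : ℕ} (hp : 2 ≤ p) (hj : 1 ≤ j) :
    ∃ e r, r < p - 1 ∧ j = (p - 1) * e + r + 1 := by
  refine ⟨(j - 1) / (p - 1), (j - 1) % (p - 1), Nat.mod_lt _ (by omega), ?_⟩
  rw [Nat.div_add_mod]
  omega

theorem not_dvd_index {p j : ℕ} (hp : 2 ≤ p) (hj : 1 ≤ j) : ¬ p ∣ index p j := by
  obtain ⟨e, r, hr, rfl⟩ := exists_eq_mul_add_add_one hp hj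
  rw [index_succ p e hr, add_assoc, Nat.dvd_add_right (Nat.dvd_mul_right p e)]
  exact Nat.not_dvd_of_pos_of_lt (by omega) (by omega)

theorem index_lt_pow {p n j : ℕ} (hp : p.Prime) (hn : 0 < n) (hj : 1 ≤ j)
    (h : j ≤ Nat.totient (p ^ n)) : index p j < p ^ n := by
  obtain ⟨e, r, hr, rfl⟩ := exists_eq_mul_add_add_one hp.two_le hj
  rw [Nat.totient_prime_pow hp hn] at h
  obtain ⟨k, rfl⟩ : ∃ k, n = k + 1 := ⟨n - 1, by omega⟩
  simp only [Nat.add_sub_cancel] at h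
  have he : e < p ^ k := by
    refine lt_of_mul_lt_mul_left (a := p - 1) ?_ (Nat.zero_le _)
    rw [mul_comm (p ^ k)] at h
    omega
  rw [index_succ p e hr]
  calc p * e + r + 1 < p * (e + 1) := by
        rw [mul_add]
        omega
    _ ≤ p * p ^ k := Nat.mul_le_mul_left _ he
    _ = p ^ (k + 1) := by ring

theorem index_strictMono (p : ℕ) : StrictMono (index p) := by
  refine strictMono_nat_of_lt_succ fun j => ?_
  have : (j - 1) / (p - 1) ≤ (j + 1 - 1) / (p - 1) := Nat.div_le_div_right (by omega)
  simp only [index]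
  omega

theorem index_add_le {p : ℕ} (hp : 2 ≤ p) (j k : ℕ) : index p (j + k) ≤ index p j + 2 * k := by
  have h : (j + k - 1) / (p - 1) ≤ (j - 1) / (p - 1) + k := by
    calc (j + k - 1) / (p - 1) ≤ (j - 1 + k * (p - 1)) / (p - 1) := by
          refine Nat.div_le_div_right ?_
          have : k * 1 ≤ k * (p - 1) := Nat.mul_le_mul_left _ (by omega)
          omega
      _ = _ := Nat.add_mul_div_right _ _ (by omega)
  simp only [index]
  omega

/-- No integer prime to `p` lies strictly between two consecutive values of `index p`. -/
theorem filter_Icc_index_succ {p j : ℕ} (hp : 2 ≤ p) (hj : 1 ≤ j) :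
    (Icc 1 (index p (j + 1))).filter (fun x => ¬ p ∣ x) =
      insert (index p (j + 1)) ((Icc 1 (index p j)).filter fun x => ¬ p ∣ x) := by
  have hlt : index p j < index p (j + 1) := index_strictMono p (Nat.lt_succ_self j)
  have hnd := not_dvd_index hp (Nat.succ_le_succ (Nat.zero_le j))
  have gap : ∀ x, index p j < x → x < index p (j + 1) → p ∣ x := by
    intro x h1 h2
    obtain ⟨e, r, hr, rfl⟩ := exists_eq_mul_add_add_one hp hj
    rw [index_succ p e hr] at h1
    by_cases h : r + 1 < p - 1
    · rw [add_assoc _ r 1, index_succ p e h] at h2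
      omega
    · have h3 : (p - 1) * e + r + 1 + 1 = (p - 1) * (e + 1) + 0 + 1 := by
        rw [mul_add]
        omega
      rw [h3, index_succ p (e + 1) (r := 0) (by omega)] at h2
      refine ⟨e + 1, ?_⟩
      rw [mul_add] at h2 ⊢
      omega
  ext x
  simp only [mem_filter, mem_Icc, mem_insert]
  constructor
  · rintro ⟨⟨h1, h2⟩, h3⟩
    by_contra h4
    push Not at h4
    refine h3 (gap x ?_ (lt_of_le_of_ne h2 h4.1))
    by_contra h5
    exact h3 (h4.2 ⟨h1, not_lt.1 h5⟩)
  · rintro (rfl | ⟨⟨h1, h2⟩, h3⟩)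
    · exact ⟨⟨by omega, le_rfl⟩, hnd⟩
    · exact ⟨⟨h1, by omega⟩, h3⟩

section

variable (p n : ℕ) [Fact p.Prime] (ab : (ZMod (p ^ n))ˣ × (ZMod (p ^ n))ˣ)

theorem vertex_succ_sub_vertex {j : ℕ} (hj : 1 ≤ j) :
    vertex p n ab (j + 1) - vertex p n ab j =
      (((1 : ℝ) / (p : ℝ) ^ ((n : ℝ) / 2) : ℝ) : ℂ) *
        ZMod.stdAddChar ((ab.1 : ZMod (p ^ n)) * (index p (j + 1) : ZMod (p ^ n)) +
          (ab.2 : ZMod (p ^ n)) * (index p (j + 1) : ZMod (p ^ n))⁻¹) := by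
  have hlt : index p j < index p (j + 1) := index_strictMono p (Nat.lt_succ_self j)
  rw [vertex, vertex, partialSum, partialSum, ← mul_sub,
    filter_Icc_index_succ (Fact.out : p.Prime).two_le hj, sum_insert (by simp; omega),
    add_sub_cancel_right]

theorem norm_vertex_one_le : ‖vertex p n ab 1‖ ≤ 1 := by
  have hp : p.Prime := Fact.out
  have h1 : (Icc 1 (index p 1)).filter (fun x => ¬ p ∣ x) = {1} := by
    ext x
    simp only [index, mem_filter, mem_Icc, mem_singleton, Nat.sub_self, Nat.zero_div, add_zero]
    constructor
    · omega
    · rintro rfl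
      simpa using hp.one_lt.ne'
  rw [vertex, partialSum, h1, sum_singleton, norm_mul, AddChar.norm_apply, mul_one,
    Complex.norm_real, Real.norm_of_nonneg (by positivity)]
  refine div_le_one_of_le₀ (Real.one_le_rpow ?_ (by positivity)) (by positivity)
  exact_mod_cast hp.one_lt.le

end

/-- The fraction of the `i`-th unit segment that lies to the left of `y`. -/
def ramp (y : ℝ) (i : ℕ) : ℝ := max 0 (min 1 (y - i))

theorem ramp_mono (i : ℕ) : Monotone fun y => ramp y i := fun _ _ h =>
  max_le_max le_rfl (min_le_min le_rfl (sub_le_sub_right h _))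

theorem ramp_nonneg (y : ℝ) (i : ℕ) : 0 ≤ ramp y i := le_max_left _ _

theorem ramp_le_one (y : ℝ) (i : ℕ) : ramp y i ≤ 1 := max_le zero_le_one (min_le_left _ _)

theorem ramp_eq_zero {y : ℝ} {i : ℕ} (h : y ≤ i) : ramp y i = 0 :=
  max_eq_left ((min_le_right _ _).trans (by linarith))

theorem ramp_eq_one {y : ℝ} {i : ℕ} (h : (i : ℝ) + 1 ≤ y) : ramp y i = 1 := by
  rw [ramp, min_eq_left (by linarith), max_eq_right zero_le_one]

theorem sum_ramp {y : ℝ} (hy : 0 ≤ y) (N : ℕ) : ∑ i ∈ range N, ramp y i = min y N := by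
  induction N with
  | zero => simp [hy]
  | succ N ih =>
    rw [sum_range_succ, ih]
    push_cast
    rcases le_total y N with h | h
    · rw [ramp_eq_zero h, min_eq_left h, min_eq_left (by linarith), add_zero]
    · rw [ramp, min_eq_right h]
      rcases le_total y (N + 1) with h' | h'
      · rw [min_eq_left h', min_eq_right (by linarith), max_eq_right (by linarith)]
        ring
      · rw [min_eq_right h', min_eq_left (by linarith), max_eq_right zero_le_one]

section

variable (p n : ℕ) [Fact p.Prime]

/-- The increments of the path are weighted exponential sums. -/
theorem pathFun_sub_pathFun (ab : (ZMod (p ^ n))ˣ × (ZMod (p ^ n))ˣ) {s t : ℝ}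
    (hs : s ∈ Set.Icc (0 : ℝ) 1) (ht : t ∈ Set.Icc (0 : ℝ) 1) :
    pathFun p n ab t - pathFun p n ab s =
      (((1 : ℝ) / (p : ℝ) ^ ((n : ℝ) / 2) : ℝ) : ℂ) * ∑ i ∈ range (numSeg p n),
        ((ramp (numSeg p n * t) i - ramp (numSeg p n * s) i : ℝ) : ℂ) *
          ZMod.stdAddChar ((ab.1 : ZMod (p ^ n)) * (index p (i + 2) : ZMod (p ^ n)) +
            (ab.2 : ZMod (p ^ n)) * (index p (i + 2) : ZMod (p ^ n))⁻¹) := by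
  rw [pathFun_eq_sum p n ab t ht, pathFun_eq_sum p n ab s hs, add_sub_add_left_eq_sub,
    ← sum_sub_distrib, mul_sum]
  refine sum_congr rfl fun i _ => ?_
  rw [vertex_succ_sub_vertex p n ab (Nat.le_add_left 1 i), ← mul_sub, ← Complex.ofReal_sub,
    mul_assoc, mul_comm (ZMod.stdAddChar _)]
  rfl

/-- The fourth moment of the weighted exponential sum that describes an increment of the path. -/
theorem sum_norm_pow_four_le (hn : 0 < n) (h2 : p ≠ 2) {u v : ℝ} (hu : 0 ≤ u) (huv : u ≤ v)
    (hv : v ≤ numSeg p n) :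
    ∑ ab : ZMod (p ^ n) × ZMod (p ^ n), ‖∑ i ∈ range (numSeg p n),
        ((ramp v i - ramp u i : ℝ) : ℂ) *
          ZMod.stdAddChar (ab.1 * (index p (i + 2) : ZMod (p ^ n)) +
            ab.2 * (index p (i + 2) : ZMod (p ^ n))⁻¹)‖ ^ 4 ≤
      ((p ^ n : ℕ) : ℝ) ^ 2 * (432 * (n + 1) * (v - u) ^ 2) := by
  have hp : p.Prime := Fact.out
  set S : Finset ℕ := {i ∈ range (numSeg p n) | ⌊u⌋₊ ≤ i ∧ i < ⌈v⌉₊} with hS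
  have hSr : S ⊆ range (numSeg p n) := filter_subset _ _
  have hS0 : ∀ i ∈ range (numSeg p n), i ∉ S → ramp v i - ramp u i = 0 := by
    intro i hi hiS
    simp only [hS, mem_filter, hi, true_and, not_and_or, not_le, not_lt] at hiS
    rcases hiS with h | h
    · have h1 : (i : ℝ) + 1 ≤ u := by
        refine le_trans ?_ (Nat.floor_le hu)
        exact_mod_cast h
      rw [ramp_eq_one h1, ramp_eq_one (h1.trans huv), sub_self]
    · have h1 : v ≤ i := Nat.ceil_le.1 h
      rw [ramp_eq_zero h1, ramp_eq_zero (huv.trans h1), sub_self]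
  have hsum : ∑ i ∈ S, (ramp v i - ramp u i) = v - u := by
    rw [sum_subset hSr hS0, sum_sub_distrib, sum_ramp (hu.trans huv), sum_ramp hu,
      min_eq_left hv, min_eq_left (huv.trans hv)]
  have hlt : ∀ i ∈ S, index p (i + 2) < p ^ n := by
    intro i hi
    refine index_lt_pow hp hn (by omega) ?_
    have := mem_range.1 (hSr hi)
    rw [numSeg] at this
    omega
  -- `index p` expands distances at most by the factor `2`, whence the length of the interval; the
  -- maximum with `1` only keeps `H` positive when `u = v`
  set H : ℕ := max 1 (min (2 * (⌈v⌉₊ - ⌊u⌋₊)) (p ^ n)) with hH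
  have hHT : 1 ≤ v - u → (H : ℝ) ≤ 6 * (v - u) := by
    intro h
    have h1 : (⌈v⌉₊ : ℝ) < v + 1 := Nat.ceil_lt_add_one (hu.trans huv)
    have h3 : u < ⌊u⌋₊ + 1 := Nat.lt_floor_add_one u
    have h4 : ⌊u⌋₊ ≤ ⌈v⌉₊ := (Nat.floor_mono huv).trans (Nat.floor_le_ceil v)
    rw [hH, Nat.cast_max, Nat.cast_min]
    refine max_le (by push_cast; linarith) ((min_le_left _ _).trans ?_)
    rw [Nat.cast_mul, Nat.cast_sub h4]
    push_cast
    linarith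
  have count := weighted_count_le (p := p) (n := n) hp h2 S (fun i => ramp v i - ramp u i)
    (fun i => ((index p (i + 2) : ℕ) : ℤ))
    (fun i => (index p (i + 2) : ZMod (p ^ n))⁻¹) (T := v - u)
    (m := ((index p (⌊u⌋₊ + 2) : ℕ) : ℤ)) (H := H)
    (fun i _ => sub_nonneg.2 (ramp_mono i huv))
    (fun i _ => by linarith [ramp_le_one v i, ramp_nonneg u i]) hsum
    (by omega) (by have := pow_pos hp.pos n; omega) hHT
    (fun i _ j _ hij => by
      have := (index_strictMono p).injective (Int.natCast_inj.1 hij)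
      omega)
    (fun i hi => ?_)
    (fun i _ h => not_dvd_index hp.two_le (Nat.le_add_left 1 (i + 1)) (by exact_mod_cast h))
    (fun i _ => ?_)
  · have e : ∀ ab : ZMod (p ^ n) × ZMod (p ^ n), ∑ i ∈ range (numSeg p n),
        ((ramp v i - ramp u i : ℝ) : ℂ) *
          ZMod.stdAddChar (ab.1 * (index p (i + 2) : ZMod (p ^ n)) +
            ab.2 * (index p (i + 2) : ZMod (p ^ n))⁻¹) =
        ∑ i ∈ S, ((ramp v i - ramp u i : ℝ) : ℂ) *
          ZMod.stdAddChar (ab.1 * (index p (i + 2) : ZMod (p ^ n)) +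
            ab.2 * (index p (i + 2) : ZMod (p ^ n))⁻¹) := fun ab =>
      (sum_subset hSr fun i hi hiS => by rw [hS0 i hi hiS]; simp).symm
    simp only [e]
    rw [sum_norm_pow_four_eq S (fun i => ramp v i - ramp u i)
      (fun i => (index p (i + 2) : ZMod (p ^ n)))
      (fun i => (index p (i + 2) : ZMod (p ^ n))⁻¹)]
    simp only [Int.cast_natCast] at count
    exact mul_le_mul_of_nonneg_left count (by positivity)
  · have hi' := hlt i hi
    obtain ⟨-, h1, h3⟩ := mem_filter.1 hi
    obtain ⟨k, rfl⟩ : ∃ k, i = ⌊u⌋₊ + k := ⟨i - ⌊u⌋₊, by omega⟩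
    have h4 := index_add_le hp.two_le (⌊u⌋₊ + 2) k
    have h5 := (index_strictMono p).monotone (show ⌊u⌋₊ + 2 ≤ ⌊u⌋₊ + k + 2 by omega)
    rw [add_right_comm _ 2 k] at h4
    have h6 : index p (⌊u⌋₊ + k + 2) < index p (⌊u⌋₊ + 2) + H := by omega
    rw [mem_Ico]
    exact ⟨Int.ofNat_le.2 h5, by exact_mod_cast h6⟩
  · rw [Int.cast_natCast]
    refine ZMod.coe_mul_inv_eq_one _ (Nat.Coprime.pow_right n ?_)
    exact (hp.coprime_iff_not_dvd.2 (not_dvd_index hp.two_le (Nat.le_add_left 1 (i + 1)))).symm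

/-- The fourth moment of an increment of the path, summed over all pairs of units. -/
theorem sum_norm_path_sub_path_le (hn : 0 < n) (h2 : p ≠ 2) {s t : Set.Icc (0 : ℝ) 1}
    (hst : s ≤ t) :
    ∑ ab : (ZMod (p ^ n))ˣ × (ZMod (p ^ n))ˣ, ‖path p n ab t - path p n ab s‖ ^ 4 ≤
      432 * (n + 1) * ((t : ℝ) - s) ^ 2 * (Fintype.card (ZMod (p ^ n))ˣ : ℝ) ^ 2 := by
  have hp : p.Prime := Fact.out
  have hst' : (s : ℝ) ≤ t := hst
  set N := numSeg p n
  have hNφ : (N : ℝ) ≤ Fintype.card (ZMod (p ^ n))ˣ := by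
    rw [ZMod.card_units_eq_totient]
    exact_mod_cast Nat.sub_le _ _
  let g : ZMod (p ^ n) × ZMod (p ^ n) → ℝ := fun ab => ‖∑ i ∈ range N,
    ((ramp (N * t) i - ramp (N * s) i : ℝ) : ℂ) *
      ZMod.stdAddChar (ab.1 * (index p (i + 2) : ZMod (p ^ n)) +
        ab.2 * (index p (i + 2) : ZMod (p ^ n))⁻¹)‖ ^ 4
  have hg := sum_norm_pow_four_le p n hn h2 (u := N * s) (v := N * t)
    (mul_nonneg (by positivity) s.2.1) (mul_le_mul_of_nonneg_left hst' (by positivity))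
    (mul_le_of_le_one_right (by positivity) t.2.2)
  have hq : (0 : ℝ) < ((p ^ n : ℕ) : ℝ) := by exact_mod_cast pow_pos hp.pos n
  have hnorm : ‖(((1 : ℝ) / (p : ℝ) ^ ((n : ℝ) / 2) : ℝ) : ℂ)‖ ^ 4 =
      1 / ((p ^ n : ℕ) : ℝ) ^ 2 := by
    rw [Complex.norm_real, Real.norm_of_nonneg (by positivity), div_pow, one_pow,
      ← Real.rpow_natCast, ← Real.rpow_mul (by positivity)]
    congr 1
    rw [show (n : ℝ) / 2 * (4 : ℕ) = ((n * 2 : ℕ) : ℝ) by push_cast; ring, Real.rpow_natCast,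
      pow_mul]
    push_cast
    rfl
  have hpath : ∀ ab : (ZMod (p ^ n))ˣ × (ZMod (p ^ n))ˣ,
      ‖path p n ab t - path p n ab s‖ ^ 4 = 1 / ((p ^ n : ℕ) : ℝ) ^ 2 * g (ab.1, ab.2) := by
    intro ab
    have h : path p n ab t - path p n ab s = pathFun p n ab t - pathFun p n ab s := rfl
    rw [h, pathFun_sub_pathFun p n ab s.2 t.2, norm_mul, mul_pow, hnorm]
  -- all terms being nonnegative, the sum over units is at most the sum over all residues
  have hunits : ∑ ab : (ZMod (p ^ n))ˣ × (ZMod (p ^ n))ˣ, g (ab.1, ab.2) ≤ ∑ ab, g ab := by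
    have inj : Function.Injective fun ab : (ZMod (p ^ n))ˣ × (ZMod (p ^ n))ˣ =>
        ((ab.1 : ZMod (p ^ n)), (ab.2 : ZMod (p ^ n))) := fun a b h =>
      Prod.ext (Units.ext (congrArg Prod.fst h)) (Units.ext (congrArg Prod.snd h))
    exact (sum_map univ ⟨_, inj⟩ g).symm.trans_le
      (sum_le_univ_sum_of_nonneg fun ab => by positivity)
  calc _ = 1 / ((p ^ n : ℕ) : ℝ) ^ 2 *
        ∑ ab : (ZMod (p ^ n))ˣ × (ZMod (p ^ n))ˣ, g (ab.1, ab.2) := by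
        rw [mul_sum]
        exact sum_congr rfl fun ab _ => hpath ab
    _ ≤ 1 / ((p ^ n : ℕ) : ℝ) ^ 2 *
        (((p ^ n : ℕ) : ℝ) ^ 2 * (432 * (n + 1) * (N * t - N * s) ^ 2)) :=
        mul_le_mul_of_nonneg_left (hunits.trans hg) (by positivity)
    _ = 432 * (n + 1) * ((t : ℝ) - s) ^ 2 * (N : ℝ) ^ 2 := by
        field_simp
    _ ≤ _ := by gcongr

/-- The moment bound required by Kolmogorov's criterion, with a constant that does not depend
on `p`. -/
theorem lintegral_law_le (hn : 0 < n) (h2 : p ≠ 2) {s t : Set.Icc (0 : ℝ) 1} (hst : s ≤ t) :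
    ∫⁻ f, ENNReal.ofReal (‖f t - f s‖ ^ 4) ∂law p n ≤
      ENNReal.ofReal (432 * (n + 1) * ((t : ℝ) - s) ^ 2) := by
  have hmeas : Measurable fun f : C(Set.Icc (0 : ℝ) 1, ℂ) =>
      ENNReal.ofReal (‖f t - f s‖ ^ 4) :=
    (ENNReal.continuous_ofReal.comp (by fun_prop)).measurable
  rw [law, lintegral_map hmeas (measurable_path p n), uniformOn, ProbabilityTheory.cond,
    Measure.restrict_univ, lintegral_smul_measure, lintegral_count, tsum_fintype,
    ← ENNReal.ofReal_sum_of_nonneg (fun _ _ => by positivity), smul_eq_mul,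
    ← ENNReal.div_eq_inv_mul]
  refine ENNReal.div_le_of_le_mul ?_
  rw [Measure.count_univ, ENat.card_eq_coe_fintype_card, ENat.toENNReal_coe,
    ← ENNReal.ofReal_natCast, ← ENNReal.ofReal_mul (by positivity), Fintype.card_prod]
  refine ENNReal.ofReal_le_ofReal ((sum_norm_path_sub_path_le p n hn h2 hst).trans_eq ?_)
  push_cast
  ring

theorem ae_law_norm_zero_le : ∀ᵐ f ∂law p n, ‖f 0‖ ≤ 1 := by
  have hmeas : MeasurableSet {f : C(Set.Icc (0 : ℝ) 1, ℂ) | ‖f 0‖ ≤ 1} :=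
    (isClosed_le (by fun_prop) continuous_const).measurableSet
  rw [law, ae_map_iff (measurable_path p n).aemeasurable hmeas]
  refine Filter.Eventually.of_forall fun ab => ?_
  have h : path p n ab 0 = vertex p n ab 1 := by
    change pathFun p n ab 0 = _
    simp [pathFun, segIndex]
  rw [h]
  exact norm_vertex_one_le p n ab

end

end KloostermanPath

end

theorem mainTheorem5 (n : ℕ) (hn : 2 ≤ n) :
    MeasureTheory.IsTightMeasureSet
      {μ : MeasureTheory.Measure C(Set.Icc (0 : ℝ) 1, ℂ) |
        ∃ (p : ℕ) (_ : Fact p.Prime), p ≠ 2 ∧ μ = KloostermanPath.law p n} := by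
  refine KloostermanPath.isTightMeasureSet_of_lintegral_pow_four_le
    (C := 432 * (n + 1)) (R := 1) (by positivity) ?_ ?_
  · rintro _ ⟨p, _, -, rfl⟩
    exact KloostermanPath.ae_law_norm_zero_le p n
  · rintro _ ⟨p, _, hp2, rfl⟩ s t hst
    exact KloostermanPath.lintegral_law_le p n (by omega) hp2 hst
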